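/- Let $L/K$ be a finite separable field extension with normal closure $\widetilde L$, and put $G=\mathrm{Gal}(\widetilde L/K)$, $G'=\mathrm{Gal}(\widetilde L/L)$; let $\lambda:G\to \mathrm{Perm}(G/G')$ be the action of $G$ on left cosets by left translation. A Hopf Galois structure on $L/K$ is a finite cocommutative $K$-Hopf algebra $\mathcal H$ together with a Hopf action on $L$, i.e. a $K$-linear map $\mu:\mathcal H\to \mathrm{End}_K(L)$ that makes $L$ a left $\mathcal H$-module algebra and induces an isomorphism of $K$-vector spaces $L\otimes_K\mathcal H\to \mathrm{End}_K(L)$. It has type $T$ (for a group $T$) if there is a regular subgroup $N\cong T$ of $\mathrm{Perm}(G/G')$, normalized by $\lambda(G)$, to which it corresponds: $\mathcal H$ is isomorphic, as a $K$-Hopf algebra acting on $L$, to $\widetilde L[N]^G$ (where $G$ acts on $\widetilde L$ by field automorphisms and on $N$ by conjugation through $\lambda$), with the action on $L$ induced by $n\mapsto n^{-1}(\overline 1)$, where $\overline 1\in G/G'$ is the class of $1$ and a coset $gG'$ is regarded as the embedding $y\mapsto g(y)$ of $L$ in $\widetilde L$. Let $p$ be an odd prime, and write $C_m$ for the cyclic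 group of order $m$. Let $H_p\subset \mathrm{GL}(3,\mathbb F_p)$ be the Heisenberg group of upper unitriangular matrices, and let $$G_p=\left\{\begin{pmatrix}1+pb & a\\ 0& 1\end{pmatrix} : a,b\in \mathbb Z/p^2\mathbb Z\right\}\subset \mathrm{GL}(2,\mathbb Z/p^2\mathbb Z)$$ (the nonabelian group of order $p^3$ and exponent $p^2$). **Theorem.** Let $L/K$ be a separable field extension of degree $p^3$. 1. If $L/K$ has a Hopf Galois structure of type $H_p$, then $L/K$ has a Hopf Galois structure of type $C_p\times C_p\times C_p$. 2. If $L/K$ has a Hopf Galois structure of type $G_p$, then $L/K$ has a Hopf Galois structure of type $C_{p^2}\times C_p$. -/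

import Mathlib

open scoped TensorProduct MonoidAlgebra

noncomputable section

namespace HopfGalois

/-! ### Hopf Galois structures -/

/-- A Hopf Galois structure on `L/K` with underlying finite cocommutative `K`-Hopf algebra `H`:
a Hopf action of `H` on `L`, i.e. a left `H`-module algebra structure on `L` such that the induced
`K`-linear map `L ⊗ H → End_K(L)`, `x ⊗ h ↦ (y ↦ x * (h • y))`, is bijective. -/
structure HopfGaloisStructure (K L H : Type*) [Field K] [Field L] [Algebra K L]
    [Ring H] [HopfAlgebra K H] [Coalgebra.IsCocomm K H] [Module.Finite K H] where
  /-- the action, a left `H`-module structure on `L` extending the `K`-module structure -/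
  action : H →ₐ[K] Module.End K L
  /-- `h • 1 = ε(h) 1` -/
  action_one : ∀ h : H, action h 1 = algebraMap K L (Coalgebra.counit (R := K) h)
  /-- `h • (x * y) = ∑ (h₁ • x) * (h₂ • y)`, where `Δ(h) = ∑ h₁ ⊗ h₂` -/
  action_mul : ∀ (h : H) (x y : L), action h (x * y) =
    LinearMap.mul' K L (TensorProduct.map (action.toLinearMap.flip x) (action.toLinearMap.flip y)
      (Coalgebra.comul (R := K) h))
  /-- `L ⊗ H → End_K(L)` is bijective -/
  bijective : Function.Bijective
    (TensorProduct.lift ((LinearMap.mul K (Module.End K L)).compl₁₂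
      (LinearMap.mul K L) action.toLinearMap) : L ⊗[K] H →ₗ[K] Module.End K L)

/-! ### The permutation group attached to `L/K` -/

section Galois

variable (K L E : Type*) [Field K] [Field L] [Field E] [Algebra K L] [Algebra K E] [Algebra L E]
  [IsScalarTower K L E]

/-- The subgroup `G' = Gal(E/L)` of `G = Gal(E/K)`: the automorphisms fixing `L` pointwise. -/
def galSubgroup : Subgroup (E ≃ₐ[K] E) :=
  (IsScalarTower.toAlgHom K L E).fieldRange.fixingSubgroup

/-- The set of left cosets `G/G'`. -/
abbrev Cosets : Type _ := (E ≃ₐ[K] E) ⧸ galSubgroup K L E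

/-- The action `λ : G → Perm(G/G')` of `G` on the left cosets by left translation. -/
def lam : (E ≃ₐ[K] E) →* Equiv.Perm (Cosets K L E) :=
  MulAction.toPermHom (E ≃ₐ[K] E) (Cosets K L E)

/-- A coset `g G'` determines the `K`-embedding `y ↦ g y` of `L` in `E`. -/
def cosetEval (q : Cosets K L E) (y : L) : E :=
  Quotient.liftOn' q (fun g : E ≃ₐ[K] E => g (algebraMap L E y)) (by
    intro g g' h
    have h1 : g⁻¹ * g' ∈ galSubgroup K L E := QuotientGroup.leftRel_apply.mp h
    have h2 := (IntermediateField.mem_fixingSubgroup_iff _ _).mp h1 (algebraMap L E y) ⟨y, rfl⟩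
    have h3 := congrArg g h2
    simpa [AlgEquiv.mul_apply] using h3.symm)

end Galois

/-- A subgroup `N` of `Perm(X)` is regular if for all `x, y` in `X` there is exactly one element
of `N` sending `x` to `y`. -/
def IsRegular {X : Type*} (N : Subgroup (Equiv.Perm X)) : Prop :=
  ∀ x y : X, ∃! n : N, (n : Equiv.Perm X) x = y

/-! ### The Hopf Galois structure attached to a regular subgroup -/

section Correspondence

variable {K L E : Type*} [Field K] [Field L] [Field E] [Algebra K L] [Algebra K E] [Algebra L E]
  [IsScalarTower K L E] {N : Subgroup (Equiv.Perm (Cosets K L E))}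

/-- Conjugation by `λ(σ)` on a subgroup `N` normalized by `λ(G)`. -/
def conjHom (hN : (lam K L E).range ≤ Subgroup.normalizer (N : Set (Equiv.Perm (Cosets K L E))))
    (σ : E ≃ₐ[K] E) : N →* N where
  toFun n := ⟨lam K L E σ * n * (lam K L E σ)⁻¹,
    (Subgroup.mem_normalizer_iff.mp (hN ⟨σ, rfl⟩) n).mp n.2⟩
  map_one' := by ext; simp
  map_mul' a b := by ext; simp

/-- The action of `σ ∈ G` on the group algebra `E[N]`: on the coefficients by field automorphisms
and on `N` by conjugation through `λ`. -/
def galAct (hN : (lam K L E).range ≤ Subgroup.normalizer (N : Set (Equiv.Perm (Cosets K L E))))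
    (σ : E ≃ₐ[K] E) : E[N] →ₐ[K] E[N] :=
  (MonoidAlgebra.mapAlgHom N (σ : E →ₐ[K] E)).comp
    (MonoidAlgebra.mapDomainAlgHom K E (conjHom hN σ))

/-- The `K`-algebra `E[N]^G` of elements of `E[N]` fixed under the action of `G`. -/
def fixedAlgebra
    (hN : (lam K L E).range ≤ Subgroup.normalizer (N : Set (Equiv.Perm (Cosets K L E)))) :
    Subalgebra K E[N] :=
  ⨅ σ : E ≃ₐ[K] E, AlgHom.equalizer (galAct hN σ) (AlgHom.id K E[N])

/-- The map `E[N] × L → E` induced `E`-linearly by `(n, y) ↦ n⁻¹(1̄)(y)`, where `1̄` is the class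
of the identity in `G/G'`. -/
def groupAlgebraAct (x : E[N]) (y : L) : E :=
  x.coeff.sum fun n c => c *
    cosetEval K L E ((n : Equiv.Perm (Cosets K L E))⁻¹ (QuotientGroup.mk 1)) y

/-- The Hopf Galois structure `S` corresponds to the regular subgroup `N` normalized by `λ(G)`:
there is an isomorphism of `K`-Hopf algebras of `H` with `E[N]^G` (the sub-`K`-Hopf algebra of
`E[N]`), which carries the Hopf action of `H` on `L` to the one induced by `n ↦ n⁻¹(1̄)`.
Compatibility with the comultiplications is expressed in `E[N] ⊗_E E[N]`. -/
def CorrespondsTo {H : Type*} [Ring H] [HopfAlgebra K H] [Coalgebra.IsCocomm K H]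
    [Module.Finite K H] (S : HopfGaloisStructure K L H)
    (hN : (lam K L E).range ≤ Subgroup.normalizer (N : Set (Equiv.Perm (Cosets K L E)))) : Prop :=
  ∃ e : H ≃ₐ[K] fixedAlgebra hN,
    (∀ h : H, Coalgebra.counit (R := E) (e h : E[N]) =
      algebraMap K E (Coalgebra.counit (R := K) h)) ∧
    (∀ h : H, Coalgebra.comul (R := E) (e h : E[N]) =
      TensorProduct.mapOfCompatibleSMul E K K E[N] E[N]
        (TensorProduct.map ((fixedAlgebra hN).val.comp (e : H →ₐ[K] fixedAlgebra hN)).toLinearMap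
          ((fixedAlgebra hN).val.comp (e : H →ₐ[K] fixedAlgebra hN)).toLinearMap
          (Coalgebra.comul (R := K) h))) ∧
    (∀ (h : H) (y : L), algebraMap L E (S.action h y) = groupAlgebraAct (e h : E[N]) y)

/-- The Hopf Galois structure `S` on `L/K` has type `T`: it corresponds to a regular subgroup of
`Perm(G/G')` normalized by `λ(G)` which is isomorphic to `T`. -/
def HasType (E : Type*) [Field E] [Algebra K E] [Algebra L E] [IsScalarTower K L E]
    {H : Type*} [Ring H] [HopfAlgebra K H] [Coalgebra.IsCocomm K H]
    [Module.Finite K H] (S : HopfGaloisStructure K L H) (T : Type*) [Group T] : Prop :=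
  ∃ (N : Subgroup (Equiv.Perm (Cosets K L E)))
    (hN : (lam K L E).range ≤ Subgroup.normalizer (N : Set (Equiv.Perm (Cosets K L E)))),
    IsRegular N ∧ Nonempty (N ≃* T) ∧ CorrespondsTo S hN

end Correspondence

universe w

/-- `L/K`, with normal closure `E`, has a Hopf Galois structure of type `T`. The underlying Hopf
algebra, being a finite-dimensional `K`-vector space, may be taken in the universe of `E`. -/
def HasHopfGaloisStructureOfType (K L : Type*) (E : Type w) [Field K] [Field L] [Field E]
    [Algebra K L] [Algebra K E] [Algebra L E] [IsScalarTower K L E] (T : Type*) [Group T] : Prop :=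
  ∃ (H : Type w) (_ : Ring H) (_ : HopfAlgebra K H) (_ : Coalgebra.IsCocomm K H)
    (_ : Module.Finite K H) (S : HopfGaloisStructure K L H), HasType E S T

/-! ### The four noncyclic groups of order `p ^ 3` -/

/-- `H_p`: upper unitriangular `3 × 3` matrices over `𝔽_p`. -/
def Heisenberg (p : ℕ) : Subgroup (GL (Fin 3) (ZMod p)) where
  carrier := {g | ∃ a b c : ZMod p, (g : Matrix (Fin 3) (Fin 3) (ZMod p)) =
    !![1, a, b; 0, 1, c; 0, 0, 1]}
  one_mem' := ⟨0, 0, 0, by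
    ext i j
    fin_cases i <;> fin_cases j <;> simp⟩
  mul_mem' := by
    rintro g g' ⟨a, b, c, h⟩ ⟨a', b', c', h'⟩
    refine ⟨a' + a, b' + (a * c' + b), c' + c, ?_⟩
    rw [Units.val_mul, h, h']
    simp
  inv_mem' := by
    rintro g ⟨a, b, c, h⟩
    refine ⟨-a, a * c - b, -c, ?_⟩
    refine Units.inv_eq_of_mul_eq_one_right ?_
    rw [h]
    simp [Matrix.one_fin_three]

/-- `G_p`: the matrices `[1 + p b, a; 0, 1]` over `ℤ/p²ℤ`. -/
def Gp (p : ℕ) : Subgroup (GL (Fin 2) (ZMod (p ^ 2))) where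
  carrier := {g | ∃ a b : ZMod (p ^ 2), (g : Matrix (Fin 2) (Fin 2) (ZMod (p ^ 2))) =
    !![1 + (p : ZMod (p ^ 2)) * b, a; 0, 1]}
  one_mem' := ⟨0, 0, by
    ext i j
    fin_cases i <;> fin_cases j <;> simp⟩
  mul_mem' := by
    rintro g g' ⟨a, b, h⟩ ⟨a', b', h'⟩
    refine ⟨(1 + p * b) * a' + a, b + b' + p * b * b', ?_⟩
    rw [Units.val_mul, h, h']
    ext i j
    fin_cases i <;> fin_cases j <;> simp [Matrix.mul_apply, Fin.sum_univ_two]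
    ring
  inv_mem' := by
    rintro g ⟨a, b, h⟩
    have hp : (p : ZMod (p ^ 2)) * p = 0 := by
      have h0 : ((p ^ 2 : ℕ) : ZMod (p ^ 2)) = 0 := ZMod.natCast_self (p ^ 2)
      push_cast at h0
      rw [← h0]
      ring
    refine ⟨-((1 - p * b) * a), -b, ?_⟩
    refine Units.inv_eq_of_mul_eq_one_right ?_
    rw [h]
    ext i j
    fin_cases i <;> fin_cases j <;> simp [Matrix.mul_apply, Fin.sum_univ_two] <;> grind

end HopfGalois

end

namespace HopfGalois

/-! ### The abelian regular subgroup attached to a group of odd order and class at most two -/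

/-! Only half of the Greither-Pareigis correspondence needs proof. The definition of type already
provides a regular subgroup `N`, normalized by `λ(G)`, of the nonabelian type. It is enough to find
a regular subgroup `M` of the abelian type normalized by everything that normalizes `N`, and then to
attach a Hopf Galois structure to `M`.

The group `M` comes from the Baer correspondence. Both `H_p` and `G_p` have odd order and class at
most two. After identifying the cosets with `N`, let `M` consist of the permutations `y ↦ a * y *
a`. Commutators are central and central elements have central square roots, so these permutations
form an abelian group. Squaring is injective, so `M` is regular. A permutation `g` normalizing the
left translations has the form `y ↦ φ y * c`, and moving `c` past `φ a` costs a central square, so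
`g` normalizes `M` too (`exists_conj_sandwich`). The map `a ↦ sandwich a` respects powers, which
determines `M`: it is elementary abelian of rank three for `H_p`, and generated by independent
elements of orders `p ^ 2` and `p` for `G_p`.

For the Hopf Galois structure, Galois descent provides an `E`-basis of the group algebra `E[M]`
consisting of fixed vectors, so `E[M]^G` is a `K`-form of `E[M]` and inherits its Hopf algebra
structure. Regularity makes the embeddings of `L` attached to the elements of `M` distinct, hence
linearly independent; this gives injectivity of `L ⊗ E[M]^G → End_K(L)`, and a dimension count gives
bijectivity. -/

/-- Commutators are central, i.e. the group is nilpotent of class at most two. -/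
def CommutatorsCentral (N : Type*) [Group N] : Prop :=
  ∀ a b : N, ∃ z ∈ Subgroup.center N, a * b = z * (b * a)

theorem CommutatorsCentral.of_mulEquiv {N T : Type*} [Group N] [Group T] (e : N ≃* T)
    (h : CommutatorsCentral T) : CommutatorsCentral N := by
  intro a b
  obtain ⟨z, hz, h⟩ := h (e a) (e b)
  refine ⟨e.symm z, ?_, e.injective (by simpa using h)⟩
  rw [Subgroup.mem_center_iff] at hz ⊢
  intro g
  exact e.injective (by simpa using hz (e g))

section Odd

variable {N : Type*} [Group N]

/-- In a group of order `2k + 1`, raising to the power `k + 1` undoes squaring. -/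
theorem eq_of_mul_self_eq (hodd : Odd (Nat.card N)) {a b : N} (h : a * a = b * b) : a = b := by
  obtain ⟨k, hk⟩ := hodd
  have key : ∀ c : N, (c * c) ^ (k + 1) = c := by
    intro c
    rw [← pow_two, ← pow_mul, show 2 * (k + 1) = Nat.card N + 1 by omega, pow_succ, pow_card_eq_one',
      one_mul]
  rw [← key a, h, key]

theorem exists_center_mul_self_eq (hodd : Odd (Nat.card N)) {z : N}
    (hz : z ∈ Subgroup.center N) : ∃ t ∈ Subgroup.center N, t * t = z := by
  obtain ⟨k, hk⟩ := hodd
  refine ⟨z ^ (k + 1), pow_mem hz _, ?_⟩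
  rw [← pow_add, show k + 1 + (k + 1) = Nat.card N + 1 by omega, pow_succ, pow_card_eq_one',
    one_mul]

/-- The permutation `y ↦ a * y * a` of a group. -/
def sandwich (a : N) : Equiv.Perm N := (Equiv.mulLeft a).trans (Equiv.mulRight a)

@[simp]
theorem sandwich_apply (a y : N) : sandwich a y = a * y * a := rfl

theorem sandwich_one : sandwich (1 : N) = 1 := by ext; simp

theorem sandwich_pow (a : N) (n : ℕ) : sandwich (a ^ n) = sandwich a ^ n := by
  induction n with
  | zero => simp [sandwich_one]
  | succ n ih =>
    rw [pow_succ', pow_succ', ← ih]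
    ext y
    calc a * a ^ n * y * (a * a ^ n) = a * a ^ n * y * (a ^ n * a) := by rw [(Commute.self_pow a n).eq]
      _ = a * (a ^ n * y * a ^ n) * a := by simp only [mul_assoc]

theorem sandwich_injective (hodd : Odd (Nat.card N)) :
    Function.Injective (sandwich : N → Equiv.Perm N) := fun a b h =>
  eq_of_mul_self_eq hodd (by simpa using Equiv.congr_fun h 1)

/-- The two composites are `y ↦ (ab)y(ba)` and `y ↦ (ba)y(ab)`. The central factor between `ab` and
`ba` can be carried from one side of `y` to the other. -/
theorem sandwich_comm (hN : CommutatorsCentral N) (a b : N) :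
    sandwich a * sandwich b = sandwich b * sandwich a := by
  obtain ⟨z, hz, h⟩ := hN a b
  rw [Subgroup.mem_center_iff] at hz
  ext y
  calc a * (b * y * b) * a = (a * b) * y * (b * a) := by group
    _ = z * (b * a) * y * (b * a) := by rw [h]
    _ = (b * a) * y * (z * (b * a)) := by
      rw [← mul_assoc _ z, hz]
      simp only [mul_assoc]
    _ = b * (a * y * a) * b := by rw [← h]; group

/-- Used to absorb a mismatch between the two outer factors: `x * y * x'` is a sandwich as soon as
`x'` differs from `x` by the square of a central `t`. -/
theorem sandwich_center_mul {t : N} (ht : t ∈ Subgroup.center N) (x y : N) :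
    sandwich (t * x) y = x * y * (t * t * x) := by
  rw [Subgroup.mem_center_iff] at ht
  calc t * x * y * (t * x) = t * (x * y) * (t * x) := by simp only [mul_assoc]
    _ = x * y * (t * t * x) := by rw [← ht]; simp only [mul_assoc]

/-- If `N` has odd order and class at most two, then the permutations `y ↦ a * y * a` form a
group. It is the left regular representation of the additive group which the Baer correspondence
attaches to `N`. -/
def sandwichSubgroup (hN : CommutatorsCentral N) (hodd : Odd (Nat.card N)) :
    Subgroup (Equiv.Perm N) where
  carrier := Set.range sandwich
  one_mem' := ⟨1, sandwich_one⟩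
  mul_mem' := by
    rintro _ _ ⟨a, rfl⟩ ⟨b, rfl⟩
    obtain ⟨z, hz, h⟩ := hN b a
    obtain ⟨t, ht, rfl⟩ := exists_center_mul_self_eq hodd hz
    refine ⟨t * (a * b), ?_⟩
    ext y
    rw [sandwich_center_mul ht, ← h, Equiv.Perm.mul_apply, sandwich_apply, sandwich_apply]
    simp only [mul_assoc]
  inv_mem' := by
    rintro _ ⟨a, rfl⟩
    refine ⟨a⁻¹, ?_⟩
    rw [eq_inv_iff_mul_eq_one]
    ext
    simp [mul_assoc]

theorem sandwichSubgroup_isRegular (hN : CommutatorsCentral N) (hodd : Odd (Nat.card N)) :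
    IsRegular (sandwichSubgroup hN hodd) := by
  have : Finite N := Nat.finite_of_card_ne_zero hodd.pos.ne'
  intro x y
  -- Multiplying `a * x * a` by `x` on the right gives the square of `a * x`.
  have hinj : Function.Injective fun a : N => a * x * a := fun a b h =>
    mul_right_cancel (eq_of_mul_self_eq hodd (a := a * x) (b := b * x)
      (by simpa only [mul_assoc] using congrArg (· * x) h))
  obtain ⟨a, ha⟩ := Finite.surjective_of_injective hinj y
  refine ⟨⟨sandwich a, a, rfl⟩, ha, ?_⟩
  rintro ⟨_, b, rfl⟩ hb
  exact Subtype.ext (congrArg sandwich (hinj (hb.trans ha.symm)))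

/-- The hypothesis says that `g` normalizes the left translations, so `g y = φ y * c` with `c = g
1`. Then `g (a * y * a) = φ a * φ y * (φ a * c)`, and `φ a * c = t * t * (c * φ a)` for a central
`t`, so `b = t * φ a` works. -/
theorem exists_conj_sandwich (hN : CommutatorsCentral N) (hodd : Odd (Nat.card N))
    (g : Equiv.Perm N) (hg : ∀ a, ∃ a', ∀ y, g (a * y) = a' * g y) (a : N) :
    ∃ b, ∀ y, g (sandwich a y) = sandwich b (g y) := by
  choose φ hφ using hg
  set c := g 1 with hc
  have hval : ∀ y, g y = φ y * c := fun y => by simpa using hφ y 1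
  obtain ⟨z, hz, h⟩ := hN (φ a) c
  obtain ⟨t, ht, rfl⟩ := exists_center_mul_self_eq hodd hz
  refine ⟨t * φ a, fun y => ?_⟩
  rw [Subgroup.mem_center_iff] at hz
  rw [sandwich_center_mul ht, sandwich_apply, mul_assoc, hφ, hφ, hval a, hval y, h,
    mul_assoc (φ a), mul_assoc (φ y), ← mul_assoc c, hz, mul_assoc (t * t)]

end Odd

/-! ### Transport to a set with a regular group action -/

section Perm

variable {X : Type*} {N : Subgroup (Equiv.Perm X)}

/-- The bijection `n ↦ n x` between a regular subgroup and the set on which it acts. -/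
noncomputable def IsRegular.equiv (hr : IsRegular N) (x : X) : N ≃ X :=
  Equiv.ofBijective (fun n : N => (n : Equiv.Perm X) x)
    (Function.bijective_iff_existsUnique _ |>.2 (hr x))

theorem IsRegular.equiv_mul (hr : IsRegular N) (x : X) (a n : N) :
    hr.equiv x (a * n) = (a : Equiv.Perm X) (hr.equiv x n) := rfl

theorem IsRegular.map_permCongr {Y : Type*} {M : Subgroup (Equiv.Perm Y)} (hM : IsRegular M)
    (e : Y ≃ X) : IsRegular (M.map (e.permCongrHom : Equiv.Perm Y →* Equiv.Perm X)) := by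
  intro x y
  obtain ⟨m, hm, huniq⟩ := hM (e.symm x) (e.symm y)
  refine ⟨⟨e.permCongrHom m, m, m.2, rfl⟩, by simp [hm], ?_⟩
  rintro ⟨_, n, hn, rfl⟩ h
  have := huniq ⟨n, hn⟩ (by simpa [Equiv.eq_symm_apply] using h)
  subst this
  rfl

/-- The bijection `n ↦ n x` turns `N` into its left translations. An element `g` of the normalizer
becomes a permutation of `N` as in `exists_conj_sandwich`, with `a' = g * a * g⁻¹`. -/
theorem exists_isRegular_normalizer_le [Nonempty X] (hr : IsRegular N)
    (hN : CommutatorsCentral N) (hodd : Odd (Nat.card N)) :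
    ∃ M : Subgroup (Equiv.Perm X),
      Subgroup.normalizer (N : Set (Equiv.Perm X)) ≤ Subgroup.normalizer (M : Set (Equiv.Perm X)) ∧
      IsRegular M ∧ Nonempty (M ≃* sandwichSubgroup hN hodd) := by
  obtain ⟨x⟩ := ‹Nonempty X›
  set e := hr.equiv x with he
  refine ⟨(sandwichSubgroup hN hodd).map (e.permCongrHom : Equiv.Perm N →* Equiv.Perm X), ?_,
    (sandwichSubgroup_isRegular hN hodd).map_permCongr e,
    ⟨(e.permCongrHom.subgroupMap _).symm⟩⟩
  have key : ∀ g ∈ Subgroup.normalizer (N : Set (Equiv.Perm X)),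
      ∀ m ∈ (sandwichSubgroup hN hodd).map (e.permCongrHom : Equiv.Perm N →* Equiv.Perm X),
      g * m * g⁻¹ ∈
        (sandwichSubgroup hN hodd).map (e.permCongrHom : Equiv.Perm N →* Equiv.Perm X) := by
    rintro g hg _ ⟨_, ⟨a, rfl⟩, rfl⟩
    obtain ⟨b, hb⟩ := exists_conj_sandwich hN hodd ((e.trans g).trans e.symm) (fun a => by
      refine ⟨⟨g * a * g⁻¹, (Subgroup.mem_normalizer_iff.mp hg a).mp a.2⟩, fun y => ?_⟩
      apply e.injective
      rw [he, hr.equiv_mul]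
      simp [hr.equiv_mul]) a
    refine ⟨sandwich b, ⟨b, rfl⟩, ?_⟩
    ext z
    have := congrArg e (hb (e.symm (g⁻¹ z)))
    simpa [-sandwich_apply] using this.symm
  intro g hg
  rw [Subgroup.mem_normalizer_iff]
  refine fun m => ⟨key g hg m, fun h => ?_⟩
  simpa [mul_assoc] using key g⁻¹ (inv_mem hg) _ h

end Perm

/-! ### The groups of order `p ^ 3` -/

theorem mem_center_of_coe {n : Type*} [Fintype n] [DecidableEq n] {R : Type*} [CommRing R]
    {H : Subgroup (GL n R)} (z : H)
    (hz : ∀ g : H, (g.1 : Matrix n n R) * (z.1 : Matrix n n R) = z.1 * g.1) :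
    z ∈ Subgroup.center H :=
  Subgroup.mem_center_iff.mpr fun g => Subtype.ext (Units.ext (hz g))

/-- The element of `H_p` with given entries. -/
def Heisenberg.mk {p : ℕ} (a b c : ZMod p) : Heisenberg p :=
  ⟨⟨!![1, a, b; 0, 1, c; 0, 0, 1], !![1, -a, a * c - b; 0, 1, -c; 0, 0, 1],
    by simp [Matrix.one_fin_three], by simp [Matrix.one_fin_three]; ring⟩, a, b, c, rfl⟩

theorem Heisenberg.commutatorsCentral (p : ℕ) : CommutatorsCentral (Heisenberg p) := by
  rintro ⟨g, a, b, c, hg⟩ ⟨g', a', b', c', hg'⟩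
  -- The upper right entries of the two products differ by `a * c' - a' * c`.
  refine ⟨Heisenberg.mk 0 (a * c' - a' * c) 0, mem_center_of_coe _ ?_, ?_⟩
  · rintro ⟨k, x, y, z, hk⟩
    simp [Heisenberg.mk, hk]
    ring
  · refine Subtype.ext (Units.ext ?_)
    simp [Heisenberg.mk, hg, hg']
    ring_nf
    simp

/-- Write `g = u + 1` with `u ^ 3 = 0`. In characteristic `p` the `p`-th power is `u ^ p + 1`, and
`u ^ p` vanishes because an odd prime is at least 3. -/
theorem Heisenberg.pow_eq_one {p : ℕ} (hp : p.Prime) (hodd : Odd p) (g : Heisenberg p) :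
    g ^ p = 1 := by
  have := Fact.mk hp
  obtain ⟨g, a, b, c, hg⟩ := g
  refine Subtype.ext (Units.ext ?_)
  change (g : Matrix (Fin 3) (Fin 3) (ZMod p)) ^ p = 1
  set u : Matrix (Fin 3) (Fin 3) (ZMod p) := !![0, a, b; 0, 0, c; 0, 0, 0] with hu
  have h1 : (g : Matrix (Fin 3) (Fin 3) (ZMod p)) = u + 1 := by
    rw [hg, hu, Matrix.one_fin_three]
    simp
  have h3 : u ^ 3 = 0 := by
    rw [hu, pow_succ, pow_two]
    ext i j
    fin_cases i <;> fin_cases j <;> simp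
  have hp3 : 3 ≤ p := by
    have := hp.two_le
    rcases hodd with ⟨k, rfl⟩
    omega
  rw [h1, add_pow_char_of_commute _ (Commute.one_right u), one_pow,
    pow_eq_zero_of_le hp3 h3, zero_add]

theorem Gp.natCast_mul_natCast (p : ℕ) : (p : ZMod (p ^ 2)) * p = 0 := by
  have h0 : ((p ^ 2 : ℕ) : ZMod (p ^ 2)) = 0 := ZMod.natCast_self (p ^ 2)
  push_cast at h0
  rw [← h0]
  ring

/-- The element `[1 + p b, a; 0, 1]` of `G_p`. -/
def Gp.mk {p : ℕ} (a b : ZMod (p ^ 2)) : Gp p :=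
  ⟨⟨!![1 + p * b, a; 0, 1], !![1 - p * b, -((1 - p * b) * a); 0, 1],
    by
      have hp := Gp.natCast_mul_natCast p
      ext i j
      fin_cases i <;> fin_cases j <;> simp [Matrix.mul_apply, Fin.sum_univ_two] <;> grind,
    by
      have hp := Gp.natCast_mul_natCast p
      ext i j
      fin_cases i <;> fin_cases j <;> simp [Matrix.mul_apply, Fin.sum_univ_two]
      grind⟩,
    a, b, rfl⟩

theorem Gp.commutatorsCentral (p : ℕ) : CommutatorsCentral (Gp p) := by
  have hp := Gp.natCast_mul_natCast p
  rintro ⟨g, a, b, hg⟩ ⟨g', a', b', hg'⟩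
  -- The upper right entries of the two products differ by this multiple of `p`; the resulting
  -- matrix is central since `p * p = 0`.
  refine ⟨Gp.mk (p * (b * a' - b' * a)) 0, mem_center_of_coe _ ?_, ?_⟩
  · rintro ⟨k, x, y, hk⟩
    simp [Gp.mk, hk]
    grind
  · refine Subtype.ext (Units.ext ?_)
    simp [Gp.mk, hg, hg']
    refine ⟨by ring, by ring⟩

theorem Gp.mk_mul_mk {p : ℕ} (a b a' b' : ZMod (p ^ 2)) :
    Gp.mk a b * Gp.mk a' b' = Gp.mk ((1 + (p : ZMod (p ^ 2)) * b) * a' + a) (b + b') := by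
  have hp := Gp.natCast_mul_natCast p
  refine Subtype.ext (Units.ext ?_)
  simp [Gp.mk]
  grind

/-- The parameter `b` matters only modulo `p`, hence the condition on `p * b`. -/
theorem Gp.mk_eq_one_iff {p : ℕ} {a b : ZMod (p ^ 2)} :
    Gp.mk a b = 1 ↔ a = 0 ∧ (p : ZMod (p ^ 2)) * b = 0 := by
  constructor
  · intro h
    have h' := congrArg (fun g : Gp p => (g.1 : Matrix (Fin 2) (Fin 2) (ZMod (p ^ 2)))) h
    simp only [Gp.mk] at h'
    have h1 := congrFun (congrFun h' 0) 1
    have h2 := congrFun (congrFun h' 0) 0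
    simp at h1 h2
    exact ⟨h1, h2⟩
  · rintro ⟨rfl, h⟩
    refine Subtype.ext (Units.ext ?_)
    simp [Gp.mk, h, Matrix.one_fin_two]

theorem Gp.mk_pow_left {p : ℕ} (n : ℕ) : (Gp.mk 1 0 : Gp p) ^ n = Gp.mk n 0 := by
  induction n with
  | zero => exact (Gp.mk_eq_one_iff.mpr ⟨by simp, by simp⟩).symm
  | succ n ih => rw [pow_succ (Gp.mk 1 0 : Gp p) n, ih, Gp.mk_mul_mk]; congr 1 <;> push_cast <;> ring

theorem Gp.mk_pow_right {p : ℕ} (n : ℕ) : (Gp.mk 0 1 : Gp p) ^ n = Gp.mk 0 n := by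
  induction n with
  | zero => exact (Gp.mk_eq_one_iff.mpr ⟨by simp, by simp⟩).symm
  | succ n ih => rw [pow_succ (Gp.mk 0 1 : Gp p) n, ih, Gp.mk_mul_mk]; congr 1 <;> push_cast <;> ring

/-! ### Recognizing abelian groups of order `p ^ 3` -/

/-- A group killed by `p` is a vector space over `ZMod p`, and its order gives its dimension. -/
theorem nonempty_mulEquiv_of_pow_eq_one {p : ℕ} (hp : p.Prime) {S : Type*} [CommGroup S]
    (hcard : Nat.card S = p ^ 3) (hS : ∀ s : S, s ^ p = 1) :
    Nonempty (S ≃* Multiplicative (ZMod p) × Multiplicative (ZMod p) × Multiplicative (ZMod p)) := by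
  have := Fact.mk hp
  have : Finite S := Nat.finite_of_card_ne_zero (by rw [hcard]; exact pow_ne_zero _ hp.ne_zero)
  let : Module (ZMod p) (Additive S) := AddCommGroup.zmodModule (n := p) fun s => hS s.toMul
  have hfr : Module.finrank (ZMod p) (Additive S) = 3 := by
    have h := Module.natCard_eq_pow_finrank (K := ZMod p) (V := Additive S)
    rw [Nat.card_zmod, show Nat.card (Additive S) = p ^ 3 from hcard] at h
    exact (Nat.pow_right_injective hp.two_le h).symm
  have e : Additive S ≃ₗ[ZMod p] ZMod p × ZMod p × ZMod p :=
    LinearEquiv.ofFinrankEq _ _ (by rw [hfr]; simp)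
  exact ⟨{ toFun := fun s => (.ofAdd (e (.ofMul s)).1, .ofAdd (e (.ofMul s)).2.1,
             .ofAdd (e (.ofMul s)).2.2)
           invFun := fun t => (e.symm (t.1.toAdd, t.2.1.toAdd, t.2.2.toAdd)).toMul
           left_inv := fun s => by simp
           right_inv := fun t => by simp
           map_mul' := fun s t => by simp [ofMul_mul, ofAdd_add] }⟩

/-- The independence condition makes the homomorphism from the product of cyclic groups injective;
equal orders make it bijective. -/
theorem nonempty_mulEquiv_of_generators {m n : ℕ} [NeZero m] [NeZero n] {S : Type*} [CommGroup S]
    (hcard : Nat.card S = m * n) (x y : S) (hx : x ^ m = 1) (hy : y ^ n = 1)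
    (hxy : ∀ i j : ℕ, x ^ i * y ^ j = 1 → m ∣ i ∧ n ∣ j) :
    Nonempty (S ≃* Multiplicative (ZMod m) × Multiplicative (ZMod n)) := by
  let fx : Multiplicative (ZMod m) →* S :=
    AddMonoidHom.toMultiplicativeLeft (ZMod.lift m ⟨(zmultiplesHom (Additive S)) (.ofMul x), by
      simpa using congrArg Additive.ofMul hx⟩)
  let fy : Multiplicative (ZMod n) →* S :=
    AddMonoidHom.toMultiplicativeLeft (ZMod.lift n ⟨(zmultiplesHom (Additive S)) (.ofMul y), by
      simpa using congrArg Additive.ofMul hy⟩)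
  have hfx : ∀ i : ℕ, fx (.ofAdd i) = x ^ i := fun i => by
    have := ZMod.lift_coe m ⟨(zmultiplesHom (Additive S)) (.ofMul x), by
      simpa using congrArg Additive.ofMul hx⟩ i
    rw [Int.cast_natCast] at this
    exact (congrArg Additive.toMul this).trans (by simp)
  have hfy : ∀ i : ℕ, fy (.ofAdd i) = y ^ i := fun i => by
    have := ZMod.lift_coe n ⟨(zmultiplesHom (Additive S)) (.ofMul y), by
      simpa using congrArg Additive.ofMul hy⟩ i
    rw [Int.cast_natCast] at this
    exact (congrArg Additive.toMul this).trans (by simp)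
  let f := fx.coprod fy
  have hinj : Function.Injective f := by
    rw [injective_iff_map_eq_one]
    rintro ⟨i, j⟩ h
    obtain ⟨i, rfl⟩ := Multiplicative.ofAdd.surjective i
    obtain ⟨j, rfl⟩ := Multiplicative.ofAdd.surjective j
    obtain ⟨i, rfl⟩ := ZMod.natCast_zmod_surjective i
    obtain ⟨j, rfl⟩ := ZMod.natCast_zmod_surjective j
    rw [MonoidHom.coprod_apply, hfx, hfy] at h
    obtain ⟨h1, h2⟩ := hxy i j h
    rw [(ZMod.natCast_eq_zero_iff i m).mpr h1, (ZMod.natCast_eq_zero_iff j n).mpr h2]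
    rfl
  have hbij : Function.Bijective f := by
    have : Finite S := Nat.finite_of_card_ne_zero (by
      rw [hcard]; exact mul_ne_zero (NeZero.ne m) (NeZero.ne n))
    rw [Nat.bijective_iff_injective_and_card]
    refine ⟨hinj, ?_⟩
    rw [hcard, Nat.card_prod]
    congr 1 <;> exact Nat.card_zmod _
  exact ⟨(MulEquiv.ofBijective f hbij).symm⟩

/-! ### Isomorphism types of the sandwich groups -/

section Types

variable {N : Type*} [Group N] (hN : CommutatorsCentral N) (hodd : Odd (Nat.card N))

/-- The sandwich permutations form an abelian group. -/
abbrev sandwichCommGroup : CommGroup (sandwichSubgroup hN hodd) where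
  mul_comm := by
    rintro ⟨_, a, rfl⟩ ⟨_, b, rfl⟩
    exact Subtype.ext (sandwich_comm hN a b)

theorem card_sandwichSubgroup : Nat.card (sandwichSubgroup hN hodd) = Nat.card N :=
  Nat.card_congr (Equiv.ofInjective _ (sandwich_injective hodd)).symm

theorem sandwichSubgroup_mulEquiv_of_heisenberg {p : ℕ} (hp : p.Prime) (hpodd : Odd p)
    (hcard : Nat.card N = p ^ 3) (e : N ≃* Heisenberg p) :
    Nonempty (sandwichSubgroup hN hodd ≃*
      Multiplicative (ZMod p) × Multiplicative (ZMod p) × Multiplicative (ZMod p)) := by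
  let := sandwichCommGroup hN hodd
  refine nonempty_mulEquiv_of_pow_eq_one hp ((card_sandwichSubgroup hN hodd).trans hcard) ?_
  rintro ⟨_, a, rfl⟩
  have ha : a ^ p = 1 := e.injective (by rw [map_pow, map_one, Heisenberg.pow_eq_one hp hpodd])
  refine Subtype.ext ?_
  change sandwich a ^ p = 1
  rw [← sandwich_pow, ha, sandwich_one]

theorem sandwichSubgroup_mulEquiv_of_gp {p : ℕ} (hp : p.Prime) (hpodd : Odd p)
    (hcard : Nat.card N = p ^ 3) (e : N ≃* Gp p) :
    Nonempty (sandwichSubgroup hN hodd ≃*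
      Multiplicative (ZMod (p ^ 2)) × Multiplicative (ZMod p)) := by
  let := sandwichCommGroup hN hodd
  have : NeZero p := ⟨hp.ne_zero⟩
  have hmem : ∀ a, sandwich a ∈ sandwichSubgroup hN hodd := fun a => ⟨a, rfl⟩
  set x := e.symm (Gp.mk 1 0)
  set y := e.symm (Gp.mk 0 1)
  have hpow : ∀ g : N, ∀ n : ℕ, g ^ n = 1 →
      (⟨sandwich g, hmem g⟩ : sandwichSubgroup hN hodd) ^ n = 1 := fun g n h => by
    refine Subtype.ext ?_
    change sandwich g ^ n = 1
    rw [← sandwich_pow, h, sandwich_one]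
  refine nonempty_mulEquiv_of_generators
    ((card_sandwichSubgroup hN hodd).trans (hcard.trans (pow_succ p 2)))
    ⟨sandwich x, hmem x⟩ ⟨sandwich y, hmem y⟩ (hpow _ _ ?_) (hpow _ _ ?_) ?_
  · rw [← map_pow, Gp.mk_pow_left, Gp.mk_eq_one_iff.mpr ⟨by simpa [pow_two] using Gp.natCast_mul_natCast p,
      by simp⟩, map_one]
  · rw [← map_pow, Gp.mk_pow_right, Gp.mk_eq_one_iff.mpr
      ⟨rfl, Gp.natCast_mul_natCast p⟩, map_one]
  · intro i j h
    have h1 : sandwich (x ^ i) * sandwich (y ^ j) = 1 := by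
      rw [sandwich_pow, sandwich_pow]
      exact congrArg Subtype.val h
    -- Evaluating at 1 turns the relation into one in `G_p`. Its diagonal entry gives `p ∣ 2 * j`;
    -- once `p ∣ j`, its upper right entry is `2 * i`, and 2 is prime to `p`.
    have h2 : x ^ i * (y ^ j * y ^ j) * x ^ i = 1 := by
      simpa [mul_assoc] using Equiv.congr_fun h1 1
    have h3 := congrArg e h2
    simp only [x, y, ← map_pow, ← map_mul, e.apply_symm_apply, Gp.mk_pow_left, Gp.mk_pow_right,
      Gp.mk_mul_mk, map_one] at h3
    obtain ⟨h4, h5⟩ := Gp.mk_eq_one_iff.mp h3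
    have h2p : Nat.Coprime p 2 := (Nat.coprime_two_right).mpr hpodd
    have h6 : p ∣ j := by
      have : ((p * (2 * j) : ℕ) : ZMod (p ^ 2)) = 0 := by
        push_cast
        linear_combination h5
      rw [ZMod.natCast_eq_zero_iff, pow_two] at this
      exact h2p.dvd_of_dvd_mul_left (Nat.dvd_of_mul_dvd_mul_left hp.pos this)
    refine ⟨?_, h6⟩
    obtain ⟨k, rfl⟩ := h6
    have : ((2 * i : ℕ) : ZMod (p ^ 2)) = 0 := by
      have hpp := Gp.natCast_mul_natCast p
      push_cast at h4 ⊢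
      linear_combination h4 - (2 * k * i : ZMod (p ^ 2)) * hpp
    rw [ZMod.natCast_eq_zero_iff] at this
    exact (h2p.pow_left 2).dvd_of_dvd_mul_left this

end Types

/-! ### Galois descent for vector spaces -/

section Descent

variable {K E V : Type*} [Field K] [Field E] [Algebra K E] [AddCommGroup V] [Module E V]
  (ρ : (E ≃ₐ[K] E) → V →+ V)

/-- If a functional `f` kills all fixed vectors, it kills the trace of `c • v` for every `c`, that
is, `∑ f (ρ σ v) * σ c = 0`. Independence of automorphisms gives `f (ρ σ v) = 0` for all `σ`, and `σ
= 1` gives `f v = 0`. -/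
theorem span_fixed_eq_top [FiniteDimensional K E]
    (hsmul : ∀ σ (c : E) v, ρ σ (c • v) = σ c • ρ σ v)
    (hone : ∀ v, ρ 1 v = v) (hmul : ∀ σ τ v, ρ (σ * τ) v = ρ σ (ρ τ v)) :
    Submodule.span E {v | ∀ σ, ρ σ v = v} = ⊤ := by
  by_contra hne
  obtain ⟨f, hf0, hf⟩ := Submodule.exists_le_ker_of_lt_top _ (lt_top_iff_ne_top.mpr hne)
  refine hf0 (LinearMap.ext fun v => ?_)
  have hfix : ∀ c : E, ∑ σ : E ≃ₐ[K] E, f (ρ σ v) * σ c = 0 := fun c => by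
    have hmem : ∑ σ : E ≃ₐ[K] E, ρ σ (c • v) ∈ {v | ∀ σ, ρ σ v = v} := fun τ => by
      rw [map_sum]
      exact Fintype.sum_equiv (Equiv.mulLeft τ) _ _ fun σ => (hmul τ σ _).symm
    have h := hf (Submodule.subset_span hmem)
    rw [LinearMap.mem_ker, map_sum] at h
    rw [← h]
    exact Finset.sum_congr rfl fun σ _ => by rw [hsmul, map_smul, smul_eq_mul, mul_comm]
  have hli : LinearIndependent E (fun σ : E ≃ₐ[K] E => (σ : E → E)) :=
    (linearIndependent_monoidHom E E).comp (fun σ : E ≃ₐ[K] E => (σ : E →* E))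
      fun σ τ h => AlgEquiv.ext fun x => DFunLike.congr_fun h x
  have h := Fintype.linearIndependent_iff.mp hli (fun σ => f (ρ σ v)) (by
    ext c
    simpa using hfix c) 1
  simpa [hone] using h

theorem exists_basis_fixed [FiniteDimensional K E]
    (hsmul : ∀ σ (c : E) v, ρ σ (c • v) = σ c • ρ σ v)
    (hone : ∀ v, ρ 1 v = v) (hmul : ∀ σ τ v, ρ (σ * τ) v = ρ σ (ρ τ v)) :
    ∃ (s : Set V) (b : Module.Basis s E V), ∀ i σ, ρ σ (b i) = b i := by
  obtain ⟨s, hs, hspan, hli⟩ := exists_linearIndependent E {v | ∀ σ, ρ σ v = v}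
  rw [span_fixed_eq_top ρ hsmul hone hmul] at hspan
  refine ⟨s, Module.Basis.mk hli (by simp [hspan]), fun i => ?_⟩
  rw [Module.Basis.mk_apply]
  exact hs i.2

variable {ρ} {ι : Type*} (b : Module.Basis ι E V)

theorem repr_semilinear (hsmul : ∀ σ (c : E) v, ρ σ (c • v) = σ c • ρ σ v)
    (hb : ∀ i σ, ρ σ (b i) = b i) (σ : E ≃ₐ[K] E) (v : V) (i : ι) :
    b.repr (ρ σ v) i = σ (b.repr v i) := by
  induction b.mem_span v using Submodule.span_induction with
  | zero => simp
  | add x y _ _ hx hy => simp [hx, hy]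
  | smul c x _ h => simp [hsmul, h]
  | mem x hx =>
    obtain ⟨j, rfl⟩ := hx
    classical
    simp only [hb, Module.Basis.repr_self, Finsupp.single_apply]
    split_ifs <;> simp

theorem mem_range_algebraMap_of_fixed [IsGalois K E] [FiniteDimensional K E] {x : E}
    (hx : ∀ σ : E ≃ₐ[K] E, σ x = x) : ∃ k : K, algebraMap K E k = x :=
  (IsGalois.mem_range_algebraMap_iff_fixed x).mpr hx

variable [Module K V] [IsScalarTower K E V]

/-- A basis of fixed vectors is a `K`-basis of the space of fixed vectors. -/
theorem exists_basis_fixedPoints [IsGalois K E] [FiniteDimensional K E]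
    (hsmul : ∀ σ (c : E) v, ρ σ (c • v) = σ c • ρ σ v)
    (hb : ∀ i σ, ρ σ (b i) = b i) (W : Submodule K V) (hW : ∀ v, v ∈ W ↔ ∀ σ, ρ σ v = v) :
    ∃ bW : Module.Basis ι K W, ∀ i, (bW i : V) = b i := by
  let w : ι → W := fun i => ⟨b i, (hW _).mpr (hb i)⟩
  have hli : LinearIndependent K w := by
    refine LinearIndependent.of_comp W.subtype ?_
    exact b.linearIndependent.restrict_scalars' K
  refine ⟨Module.Basis.mk hli ?_, fun i => by rw [Module.Basis.mk_apply]⟩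
  rintro ⟨v, hv⟩ -
  -- The coordinates of a fixed vector in a fixed basis are Galois invariant, hence lie in `K`.
  have hk : ∀ i, ∃ k : K, algebraMap K E k = b.repr v i := fun i =>
    mem_range_algebraMap_of_fixed fun σ => by
      rw [← repr_semilinear b hsmul hb, (hW v).mp hv]
  choose k hk using hk
  have : (⟨v, hv⟩ : W) = ∑ i ∈ (b.repr v).support, k i • w i := by
    apply Subtype.ext
    refine (b.linearCombination_repr v).symm.trans ?_
    simp only [Finsupp.linearCombination_apply, Finsupp.sum, AddSubmonoidClass.coe_finsetSum,
      SetLike.val_smul, w, ← hk, algebraMap_smul]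
  rw [this]
  exact Submodule.sum_mem _ fun i _ => Submodule.smul_mem _ _ (Submodule.subset_span ⟨i, rfl⟩)

end Descent

/-! ### Descent for Hopf algebras -/

section Hopf

variable {K E B : Type*} [Field K] [Field E] [Algebra K E] [Ring B] [HopfAlgebra E B]
  [Algebra K B] [IsScalarTower K E B] (A : Subalgebra K B)

/-- The map `A ⊗ A → B ⊗ B` for a `K`-form `A` of an `E`-algebra `B`. -/
def tensorIncl : A ⊗[K] A →ₐ[K] B ⊗[E] B :=
  (Algebra.TensorProduct.mapOfCompatibleSMul E K K B B).comp
    (Algebra.TensorProduct.map A.val A.val)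

@[simp]
theorem tensorIncl_tmul (x y : A) : tensorIncl (E := E) A (x ⊗ₜ y) = (x : B) ⊗ₜ[E] (y : B) := rfl

/-- The map `A ⊗ (A ⊗ A) → B ⊗ (B ⊗ B)` for a `K`-form `A` of an `E`-algebra `B`. -/
def tensorIncl₃ : A ⊗[K] (A ⊗[K] A) →ₗ[K] B ⊗[E] (B ⊗[E] B) :=
  (TensorProduct.mapOfCompatibleSMul E K K B (B ⊗[E] B)) ∘ₗ
    (TensorProduct.map A.val.toLinearMap (tensorIncl (E := E) A).toLinearMap)

@[simp]
theorem tensorIncl₃_tmul (x : A) (y : A ⊗[K] A) :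
    tensorIncl₃ (E := E) A (x ⊗ₜ y) = (x : B) ⊗ₜ[E] tensorIncl (E := E) A y := rfl

/-- Independence over `E` implies independence over `K`; the images of basis tensors are known to be
independent over `E`. -/
theorem injective_of_basis {ι W V : Type*} [AddCommGroup W] [Module K W] [AddCommGroup V]
    [Module K V] [Module E V] [IsScalarTower K E V] (f : W →ₗ[K] V) (b : Module.Basis ι K W)
    (h : LinearIndependent E (f ∘ b)) : Function.Injective f := by
  have hf : ⇑f = Finsupp.linearCombination K (f ∘ b) ∘ b.repr := by
    ext x
    rw [Function.comp_apply, ← Finsupp.apply_linearCombination, b.linearCombination_repr]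
  rw [hf]
  exact Function.Injective.comp (h.restrict_scalars' K) b.repr.injective

variable {A} {ι : Type*} {b : Module.Basis ι E B} {bA : Module.Basis ι K A}

theorem tensorIncl_injective (hb : ∀ i, (bA i : B) = b i) :
    Function.Injective (tensorIncl (E := E) A) := by
  refine injective_of_basis (E := E) (tensorIncl (E := E) A).toLinearMap (bA.tensorProduct bA) ?_
  have h : (tensorIncl (E := E) A).toLinearMap ∘ bA.tensorProduct bA = b.tensorProduct b := by
    ext ⟨i, j⟩
    simp [hb]
  rw [h]
  exact (b.tensorProduct b).linearIndependent

theorem tensorIncl₃_injective (hb : ∀ i, (bA i : B) = b i) :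
    Function.Injective (tensorIncl₃ (E := E) A) := by
  refine injective_of_basis (E := E) (tensorIncl₃ (E := E) A)
    (bA.tensorProduct (bA.tensorProduct bA)) ?_
  have h : tensorIncl₃ (E := E) A ∘ bA.tensorProduct (bA.tensorProduct bA) =
      b.tensorProduct (b.tensorProduct b) := by
    ext ⟨i, j, k⟩
    simp [hb]
  rw [h]
  exact (b.tensorProduct (b.tensorProduct b)).linearIndependent

variable (A) (hinj : Function.Injective (tensorIncl (E := E) A))
  (hΔ : ∀ a : A, Coalgebra.comul (R := E) (a : B) ∈ (tensorIncl (E := E) A).range)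
  (hε : ∀ a : A, Coalgebra.counit (R := E) (a : B) ∈ (Algebra.ofId K E).range)
  (hS : ∀ a : A, HopfAlgebra.antipode E (a : B) ∈ A)

/-- The comultiplication of a form of a Hopf algebra. -/
noncomputable def descComul : A →ₐ[K] A ⊗[K] A :=
  ((AlgEquiv.ofInjective _ hinj).symm : _ →ₐ[K] A ⊗[K] A).comp
    ((((Bialgebra.comulAlgHom E B).restrictScalars K).comp A.val).codRestrict _ hΔ)

/-- The counit of a form of a Hopf algebra. -/
noncomputable def descCounit : A →ₐ[K] K :=
  ((AlgEquiv.ofInjective (Algebra.ofId K E) (algebraMap K E).injective).symm : _ →ₐ[K] K).comp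
    ((((Bialgebra.counitAlgHom E B).restrictScalars K).comp A.val).codRestrict _ hε)

/-- The antipode of a form of a Hopf algebra. -/
def descAntipode : A →ₗ[K] A :=
  (((HopfAlgebra.antipode E (A := B)).restrictScalars K).comp A.val.toLinearMap).codRestrict
    (Subalgebra.toSubmodule A) hS

theorem tensorIncl_descComul (a : A) :
    tensorIncl A (descComul A hinj hΔ a) = Coalgebra.comul (R := E) (a : B) :=
  congrArg Subtype.val ((AlgEquiv.ofInjective _ hinj).apply_symm_apply _)

theorem algebraMap_descCounit (a : A) :
    algebraMap K E (descCounit A hε a) = Coalgebra.counit (R := E) (a : B) :=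
  congrArg Subtype.val
    ((AlgEquiv.ofInjective (Algebra.ofId K E) (algebraMap K E).injective).apply_symm_apply _)

theorem coe_descAntipode (a : A) :
    (descAntipode A hS a : B) = HopfAlgebra.antipode E (a : B) := rfl

-- Both sides are compared inside `B ⊗ (B ⊗ B)`, where the identity is coassociativity of `B`. The
-- other Hopf algebra axioms descend in the same way.
set_option synthInstance.maxHeartbeats 200000 in
theorem desc_coassoc (hinj₃ : Function.Injective (tensorIncl₃ (E := E) A)) (a : A) :
    TensorProduct.assoc K A A A (TensorProduct.map (descComul A hinj hΔ).toLinearMap .id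
      (descComul A hinj hΔ a)) =
    TensorProduct.map .id (descComul A hinj hΔ).toLinearMap (descComul A hinj hΔ a) := by
  apply hinj₃
  have h1 : ∀ (s : A ⊗[K] A) (y : A), tensorIncl₃ (E := E) A (TensorProduct.assoc K A A A (s ⊗ₜ y)) =
      TensorProduct.assoc E B B B (tensorIncl A s ⊗ₜ (y : B)) := by
    intro s y
    induction s with
    | zero => simp
    | add s t hs ht => simp only [TensorProduct.add_tmul, map_add, hs, ht]
    | tmul x z => simp
  have h2 : ∀ t : A ⊗[K] A, tensorIncl₃ (E := E) A (TensorProduct.assoc K A A A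
      (TensorProduct.map (descComul A hinj hΔ).toLinearMap .id t)) =
      TensorProduct.assoc E B B B (Coalgebra.comul.rTensor B (tensorIncl A t)) := by
    intro t
    induction t with
    | zero => simp
    | add s t hs ht => simp only [map_add, hs, ht]
    | tmul x y => simp [h1, tensorIncl_descComul]
  have h3 : ∀ t : A ⊗[K] A, tensorIncl₃ (E := E) A
      (TensorProduct.map .id (descComul A hinj hΔ).toLinearMap t) =
      Coalgebra.comul.lTensor B (tensorIncl A t) := by
    intro t
    induction t with
    | zero => simp
    | add s t hs ht => simp only [map_add, hs, ht]
    | tmul x y => simp [tensorIncl_descComul]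
  rw [h2, h3, tensorIncl_descComul, Coalgebra.coassoc_apply]

theorem desc_rTensor (a : A) :
    TensorProduct.map (descCounit A hε).toLinearMap .id (descComul A hinj hΔ a) = 1 ⊗ₜ[K] a := by
  apply (TensorProduct.lid K A).injective
  apply Subtype.val_injective
  have h : ∀ t : A ⊗[K] A, ((TensorProduct.lid K A
      (TensorProduct.map (descCounit A hε).toLinearMap .id t) : A) : B) =
      TensorProduct.lid E B (Coalgebra.counit.rTensor B (tensorIncl A t)) := by
    intro t
    induction t with
    | zero => simp
    | add s t hs ht => simp only [map_add, Subalgebra.coe_add, hs, ht]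
    | tmul x y => simp [← algebraMap_descCounit A hε]
  rw [h, tensorIncl_descComul]
  simp

theorem desc_lTensor (a : A) :
    TensorProduct.map .id (descCounit A hε).toLinearMap (descComul A hinj hΔ a) = a ⊗ₜ[K] 1 := by
  apply (TensorProduct.rid K A).injective
  apply Subtype.val_injective
  have h : ∀ t : A ⊗[K] A, ((TensorProduct.rid K A
      (TensorProduct.map .id (descCounit A hε).toLinearMap t) : A) : B) =
      TensorProduct.rid E B (Coalgebra.counit.lTensor B (tensorIncl A t)) := by
    intro t
    induction t with
    | zero => simp
    | add s t hs ht => simp only [map_add, Subalgebra.coe_add, hs, ht]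
    | tmul x y => simp [← algebraMap_descCounit A hε]
  rw [h, tensorIncl_descComul]
  simp

/-- A form `A` over `K` of a Hopf algebra `B` over `E` is a Hopf algebra, if it is stable under
the comultiplication, the counit and the antipode. -/
@[reducible]
noncomputable def descHopfAlgebra (hinj₃ : Function.Injective (tensorIncl₃ (E := E) A)) :
    HopfAlgebra K A where
  __ := Bialgebra.ofAlgHom (descComul A hinj hΔ) (descCounit A hε)
    (AlgHom.ext (desc_coassoc A hinj hΔ hinj₃))
    (AlgHom.ext (desc_rTensor A hinj hΔ hε)) (AlgHom.ext (desc_lTensor A hinj hΔ hε))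
  antipode := descAntipode A hS
  mul_antipode_rTensor_comul := by
    ext a
    have h : ∀ t : A ⊗[K] A, ((LinearMap.mul' K A ((descAntipode A hS).rTensor A t) : A) : B) =
        LinearMap.mul' E B ((HopfAlgebra.antipode E).rTensor B (tensorIncl A t)) := by
      intro t
      induction t with
      | zero => simp
      | add s t hs ht => simp only [map_add, Subalgebra.coe_add, hs, ht]
      | tmul x y => simp [coe_descAntipode]
    refine (h (descComul A hinj hΔ a)).trans ?_
    rw [tensorIncl_descComul, HopfAlgebra.mul_antipode_rTensor_comul_apply,
      ← algebraMap_descCounit A hε, ← IsScalarTower.algebraMap_apply]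
    rfl
  mul_antipode_lTensor_comul := by
    ext a
    have h : ∀ t : A ⊗[K] A, ((LinearMap.mul' K A ((descAntipode A hS).lTensor A t) : A) : B) =
        LinearMap.mul' E B ((HopfAlgebra.antipode E).lTensor B (tensorIncl A t)) := by
      intro t
      induction t with
      | zero => simp
      | add s t hs ht => simp only [map_add, Subalgebra.coe_add, hs, ht]
      | tmul x y => simp [coe_descAntipode]
    refine (h (descComul A hinj hΔ a)).trans ?_
    rw [tensorIncl_descComul, HopfAlgebra.mul_antipode_lTensor_comul_apply,
      ← algebraMap_descCounit A hε, ← IsScalarTower.algebraMap_apply]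
    rfl

theorem desc_isCocomm (hinj₃ : Function.Injective (tensorIncl₃ (E := E) A))
    [Coalgebra.IsCocomm E B] :
    letI := descHopfAlgebra A hinj hΔ hε hS hinj₃
    Coalgebra.IsCocomm K A := by
  let := descHopfAlgebra A hinj hΔ hε hS hinj₃
  refine ⟨?_⟩
  ext a
  apply hinj
  have h : ∀ t : A ⊗[K] A, tensorIncl (E := E) A (TensorProduct.comm K A A t) =
      TensorProduct.comm E B B (tensorIncl A t) := by
    intro t
    induction t with
    | zero => simp
    | add s t hs ht => simp only [map_add, hs, ht]
    | tmul x y => simp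
  refine (h (descComul A hinj hΔ a)).trans ?_
  rw [tensorIncl_descComul, Coalgebra.comm_comul]
  exact (tensorIncl_descComul A hinj hΔ a).symm

end Hopf

universe w

/-! ### The cosets as embeddings -/

section Cosets

variable {K L E : Type*} [Field K] [Field L] [Field E] [Algebra K L] [Algebra K E] [Algebra L E]
  [IsScalarTower K L E]

@[simp]
theorem cosetEval_mk (g : E ≃ₐ[K] E) (y : L) :
    cosetEval K L E (QuotientGroup.mk g) y = g (algebraMap L E y) := rfl

/-- The embedding of `L` in `E` attached to a coset. -/
def cosetHom (q : Cosets K L E) : L →ₐ[K] E where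
  toFun := cosetEval K L E q
  map_one' := by induction q using QuotientGroup.induction_on; simp
  map_mul' _ _ := by induction q using QuotientGroup.induction_on; simp
  map_zero' := by induction q using QuotientGroup.induction_on; simp
  map_add' _ _ := by induction q using QuotientGroup.induction_on; simp
  commutes' r := by
    induction q using QuotientGroup.induction_on
    rw [cosetEval_mk, ← IsScalarTower.algebraMap_apply, AlgEquiv.commutes]

@[simp]
theorem cosetHom_mk (g : E ≃ₐ[K] E) (y : L) :
    cosetHom (QuotientGroup.mk g : Cosets K L E) y = g (algebraMap L E y) := rfl

@[simp]
theorem lam_mk (σ g : E ≃ₐ[K] E) :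
    lam K L E σ (QuotientGroup.mk g) = QuotientGroup.mk (σ * g) := rfl

theorem cosetHom_lam (σ : E ≃ₐ[K] E) (q : Cosets K L E) (y : L) :
    cosetHom (lam K L E σ q) y = σ (cosetHom q y) := by
  induction q using QuotientGroup.induction_on
  simp

theorem mem_galSubgroup_iff (σ : E ≃ₐ[K] E) :
    σ ∈ galSubgroup K L E ↔ ∀ y : L, σ (algebraMap L E y) = algebraMap L E y := by
  rw [galSubgroup, IntermediateField.mem_fixingSubgroup_iff]
  exact ⟨fun h y => h _ ⟨y, rfl⟩, by rintro h _ ⟨y, rfl⟩; exact h y⟩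

/-- Two automorphisms agree on `L` exactly when they differ by an element of `G'`. -/
theorem cosetHom_injective :
    Function.Injective (cosetHom : Cosets K L E → (L →ₐ[K] E)) := by
  intro q r h
  induction q using QuotientGroup.induction_on with | H g
  induction r using QuotientGroup.induction_on with | H g'
  rw [QuotientGroup.eq, mem_galSubgroup_iff]
  intro y
  have := DFunLike.congr_fun h y
  rw [cosetHom_mk, cosetHom_mk] at this
  rw [AlgEquiv.mul_apply, ← this, ← AlgEquiv.mul_apply, inv_mul_cancel, AlgEquiv.one_apply]

variable [IsGalois K E]

theorem exists_algebraMap_eq [FiniteDimensional K E] {x : E} (hx : ∀ σ ∈ galSubgroup K L E, σ x = x) :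
    ∃ y : L, algebraMap L E y = x := by
  have h : x ∈ IntermediateField.fixedField
      (IntermediateField.fixingSubgroup (IsScalarTower.toAlgHom K L E).fieldRange) :=
    fun σ => hx σ.1 σ.2
  rw [IsGalois.fixedField_fixingSubgroup] at h
  exact h

variable (K L E) in
theorem card_cosets : Nat.card (Cosets K L E) = Module.finrank K L := by
  have h := IntermediateField.finrank_eq_fixingSubgroup_index (F := K) (E' := E)
    (L := (IsScalarTower.toAlgHom K L E).fieldRange)
  exact h.symm.trans
    (AlgEquiv.ofInjectiveField (IsScalarTower.toAlgHom K L E)).toLinearEquiv.finrank_eq.symm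

end Cosets

theorem IsRegular.card_eq {X : Type*} [Nonempty X] {N : Subgroup (Equiv.Perm X)}
    (hr : IsRegular N) : Nat.card N = Nat.card X :=
  Nat.card_congr (hr.equiv (Classical.arbitrary X))

/-! ### The Hopf Galois structure attached to a regular subgroup -/

section GreitherPareigis

variable {K L E : Type*} [Field K] [Field L] [Field E] [Algebra K L] [Algebra K E] [Algebra L E]
  [IsScalarTower K L E] {N : Subgroup (Equiv.Perm (Cosets K L E))}
  (hN : (lam K L E).range ≤ Subgroup.normalizer (N : Set (Equiv.Perm (Cosets K L E))))

@[simp]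
theorem galAct_single (σ : E ≃ₐ[K] E) (n : N) (c : E) :
    galAct hN σ (.single n c) = .single (conjHom hN σ n) (σ c) := by
  simp [galAct]

theorem mem_fixedAlgebra_iff (x : E[N]) : x ∈ fixedAlgebra hN ↔ ∀ σ, galAct hN σ x = x := by
  simp [fixedAlgebra, Algebra.mem_iInf, AlgHom.mem_equalizer]

theorem galAct_smul (σ : E ≃ₐ[K] E) (c : E) (x : E[N]) :
    galAct hN σ (c • x) = σ c • galAct hN σ x := by
  induction x using MonoidAlgebra.induction_linear with
  | zero => simp
  | add x y hx hy => simp [hx, hy]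
  | single n d => simp

theorem galAct_one (x : E[N]) : galAct hN 1 x = x := by
  induction x using MonoidAlgebra.induction_linear with
  | zero => simp
  | add x y hx hy => simp [hx, hy]
  | single n d =>
    rw [galAct_single]
    congr 1
    ext
    simp [conjHom]

theorem galAct_mul (σ τ : E ≃ₐ[K] E) (x : E[N]) :
    galAct hN (σ * τ) x = galAct hN σ (galAct hN τ x) := by
  induction x using MonoidAlgebra.induction_linear with
  | zero => simp
  | add x y hx hy => simp [hx, hy]
  | single n d =>
    simp only [galAct_single]
    congr 1
    ext
    simp [conjHom]

theorem counit_galAct (σ : E ≃ₐ[K] E) (x : E[N]) :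
    Coalgebra.counit (R := E) (galAct hN σ x) = σ (Coalgebra.counit (R := E) x) := by
  induction x using MonoidAlgebra.induction_linear with
  | zero => simp
  | add x y hx hy => simp only [map_add, hx, hy]
  | single n d => simp

theorem antipode_galAct (σ : E ≃ₐ[K] E) (x : E[N]) :
    HopfAlgebra.antipode E (galAct hN σ x) = galAct hN σ (HopfAlgebra.antipode E x) := by
  induction x using MonoidAlgebra.induction_linear with
  | zero => simp
  | add x y hx hy => simp only [map_add, hx, hy]
  | single n d => simp

theorem comul_single_eq {M : Type*} (m : M) (c : E) :
    Coalgebra.comul (R := E) (.single m c : E[M]) =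
      c • (MonoidAlgebra.single m 1 ⊗ₜ[E] MonoidAlgebra.single m 1) := by
  rw [← mul_one c, ← smul_eq_mul, ← MonoidAlgebra.smul_single, map_smul]
  simp

/-- Equivariance of the comultiplication, put in coordinates of a fixed basis so that no semilinear
action on the tensor square has to be constructed. -/
theorem repr_comul_galAct {ι : Type*} (b : Module.Basis ι E E[N])
    (hb : ∀ i σ, galAct hN σ (b i) = b i) (σ : E ≃ₐ[K] E) (x : E[N]) (i j : ι) :
    (b.tensorProduct b).repr (Coalgebra.comul (R := E) (galAct hN σ x)) (i, j) =
      σ ((b.tensorProduct b).repr (Coalgebra.comul (R := E) x) (i, j)) := by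
  induction x using MonoidAlgebra.induction_linear with
  | zero => simp
  | add x y hx hy => simp only [map_add, Finsupp.add_apply, hx, hy]
  | single n c =>
    have h := repr_semilinear (ρ := fun σ => (galAct hN σ : E[N] →+ E[N])) b
      (galAct_smul hN) hb σ (.single n 1)
    simp only [AddMonoidHom.coe_coe, galAct_single, map_one] at h
    rw [galAct_single, comul_single_eq, comul_single_eq]
    simp only [map_smul, Finsupp.smul_apply, Module.Basis.tensorProduct_repr_tmul_apply, h,
      smul_eq_mul, map_mul]

/-- The `E`-linear extension of `n ↦ n⁻¹(q)(y)` to `E[N]`. -/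
noncomputable def evalAt (q : Cosets K L E) (y : L) : E[N] →ₗ[E] E :=
  (Finsupp.linearCombination E fun n : N => cosetHom ((n : Equiv.Perm (Cosets K L E))⁻¹ q) y) ∘ₗ
    (MonoidAlgebra.coeffLinearEquiv E).toLinearMap

@[simp]
theorem evalAt_single (q : Cosets K L E) (y : L) (n : N) (c : E) :
    evalAt q y (.single n c) = c * cosetHom ((n : Equiv.Perm (Cosets K L E))⁻¹ q) y := by
  simp [evalAt]

/-- Conjugating `n` by `λ(σ)` and moving `q` by `λ(σ)` moves `n⁻¹ q` by `λ(σ)`. -/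
theorem evalAt_galAct (σ : E ≃ₐ[K] E) (q : Cosets K L E) (y : L) (x : E[N]) :
    evalAt (lam K L E σ q) y (galAct hN σ x) = σ (evalAt q y x) := by
  induction x using MonoidAlgebra.induction_linear with
  | zero => simp
  | add x y hx hy => simp only [map_add, hx, hy]
  | single n c =>
    rw [galAct_single, evalAt_single, evalAt_single, map_mul, ← cosetHom_lam]
    simp [conjHom, mul_assoc]

theorem evalAt_add (q : Cosets K L E) (y z : L) (x : E[N]) :
    evalAt q (y + z) x = evalAt q y x + evalAt q z x := by
  induction x using MonoidAlgebra.induction_linear with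
  | zero => simp
  | add x y hx hy => rw [map_add, map_add, map_add, hx, hy]; ring
  | single n c => simp [mul_add]

theorem evalAt_smul (q : Cosets K L E) (k : K) (y : L) (x : E[N]) :
    evalAt q (k • y) x = k • evalAt q y x := by
  induction x using MonoidAlgebra.induction_linear with
  | zero => simp
  | add x y hx hy => rw [map_add, map_add, hx, hy, smul_add]
  | single n c => simp

theorem evalAt_one_right (q : Cosets K L E) (x : E[N]) :
    evalAt q 1 x = Coalgebra.counit (R := E) x := by
  induction x using MonoidAlgebra.induction_linear with
  | zero => simp
  | add x y hx hy => rw [map_add, map_add, hx, hy]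
  | single n c => simp

/-- Elements of `N` are group-like and cosets act as ring homomorphisms. -/
theorem evalAt_mul_right (q : Cosets K L E) (y z : L) (x : E[N]) :
    evalAt q (y * z) x = LinearMap.mul' E E
      (TensorProduct.map (evalAt q y) (evalAt q z) (Coalgebra.comul (R := E) x)) := by
  induction x using MonoidAlgebra.induction_linear with
  | zero => simp
  | add x y hx hy => simp only [map_add, hx, hy]
  | single n c =>
    rw [comul_single_eq]
    simp

theorem evalAt_single_mul (q : Cosets K L E) (y : L) (n : N) (c : E) (x : E[N]) :
    evalAt q y (.single n c * x) = c * evalAt ((n : Equiv.Perm (Cosets K L E))⁻¹ q) y x := by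
  induction x using MonoidAlgebra.induction_linear with
  | zero => simp
  | add x y hx hy => rw [mul_add, map_add, map_add, hx, hy, mul_add]
  | single m d => simp [MonoidAlgebra.single_mul_single, mul_assoc]

/-- By regularity the cosets `n⁻¹ q` are distinct, so they give distinct embeddings of `L`, which
are linearly independent over `E`. -/
theorem eq_zero_of_evalAt_eq_zero (hr : IsRegular N) (q : Cosets K L E) {x : E[N]}
    (hx : ∀ y : L, evalAt q y x = 0) : x = 0 := by
  have hinj : Function.Injective fun n : N => (n : Equiv.Perm (Cosets K L E))⁻¹ q := fun m n h =>
    inv_injective ((hr q _).unique (y₁ := m⁻¹) (y₂ := n⁻¹) h rfl)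
  have hli : LinearIndependent E fun n : N =>
      (cosetHom ((n : Equiv.Perm (Cosets K L E))⁻¹ q) : L → E) :=
    (linearIndependent_monoidHom L E).comp
      (fun n : N => (cosetHom ((n : Equiv.Perm (Cosets K L E))⁻¹ q) : L →* E))
      fun m n h => hinj (cosetHom_injective (AlgHom.ext fun y => DFunLike.congr_fun h y))
  rw [← MonoidAlgebra.coeff_eq_zero]
  refine (linearIndependent_iff.mp hli) _ (funext fun y => ?_)
  refine Eq.trans ?_ (hx y)
  simp [evalAt, Finsupp.linearCombination_apply, Finsupp.sum, Finset.sum_apply]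

theorem algebraMap_smul_eq (k : K) (y : L) : algebraMap L E (k • y) = k • algebraMap L E y := by
  simp [Algebra.smul_def, ← IsScalarTower.algebraMap_apply]

section Invariants

variable [FiniteDimensional K E] [IsGalois K E]

/-- Elements of `G'` fix the coset of 1, so by equivariance the value is `G'`-invariant, hence in
`L`. -/
theorem exists_algebraMap_eq_evalAt (x : fixedAlgebra hN) (y : L) :
    ∃ z : L, algebraMap L E z = evalAt (QuotientGroup.mk 1) y (x : E[N]) := by
  refine exists_algebraMap_eq (K := K) fun σ hσ => ?_
  rw [← evalAt_galAct hN, (mem_fixedAlgebra_iff hN _).mp x.2, lam_mk, mul_one]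
  congr 2
  exact (QuotientGroup.eq (a := σ) (b := 1)).mpr (by simpa using hσ)

/-- The action of `E[N]^G` on `L`. -/
noncomputable def fixedAct (x : fixedAlgebra hN) (y : L) : L :=
  (exists_algebraMap_eq_evalAt hN x y).choose

theorem algebraMap_fixedAct (x : fixedAlgebra hN) (y : L) :
    algebraMap L E (fixedAct hN x y) = evalAt (QuotientGroup.mk 1) y (x : E[N]) :=
  (exists_algebraMap_eq_evalAt hN x y).choose_spec

/-- Equivariance extends the defining formula from the coset of 1 to all cosets; multiplicativity of
the action needs it at `n⁻¹ q`. -/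
theorem cosetHom_fixedAct (q : Cosets K L E) (x : fixedAlgebra hN) (y : L) :
    cosetHom q (fixedAct hN x y) = evalAt q y (x : E[N]) := by
  induction q using QuotientGroup.induction_on with | H g
  rw [cosetHom_mk, algebraMap_fixedAct, ← evalAt_galAct hN, (mem_fixedAlgebra_iff hN _).mp x.2,
    lam_mk, mul_one]

theorem evalAt_mul (q : Cosets K L E) (y : L) (x : E[N]) (x' : fixedAlgebra hN) :
    evalAt q y (x * (x' : E[N])) = evalAt q (fixedAct hN x' y) x := by
  induction x using MonoidAlgebra.induction_linear with
  | zero => simp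
  | add x y hx hy => rw [add_mul, map_add, map_add, hx, hy]
  | single n c => rw [evalAt_single_mul, evalAt_single, cosetHom_fixedAct]

/-- The action of `E[N]^G` on `L`, as a homomorphism to `End_K(L)`. -/
noncomputable def fixedAction : fixedAlgebra hN →ₐ[K] Module.End K L :=
  .ofLinearMap
    (LinearMap.mk₂ K (fixedAct hN)
      (fun x x' y => (algebraMap L E).injective (by simp [algebraMap_fixedAct]))
      (fun k x y => (algebraMap L E).injective (by
        rw [algebraMap_fixedAct, algebraMap_smul_eq, algebraMap_fixedAct]
        exact ((evalAt _ y).restrictScalars K).map_smul k (x : E[N])))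
      (fun x y y' => (algebraMap L E).injective (by simp [algebraMap_fixedAct, evalAt_add]))
      (fun k x y => (algebraMap L E).injective (by
        rw [algebraMap_fixedAct, algebraMap_smul_eq, algebraMap_fixedAct, evalAt_smul])))
    (LinearMap.ext fun y => (algebraMap L E).injective (by
      simp [algebraMap_fixedAct, MonoidAlgebra.one_def]))
    (fun x x' => LinearMap.ext fun y => (algebraMap L E).injective (by
      simp [algebraMap_fixedAct, evalAt_mul]))

theorem algebraMap_fixedAction (x : fixedAlgebra hN) (y : L) :
    algebraMap L E (fixedAction hN x y) = evalAt (QuotientGroup.mk 1) y (x : E[N]) :=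
  algebraMap_fixedAct hN x y

/-- A kernel element is `∑ xᵢ ⊗ bᵢ` with `xᵢ` in `L`. Read in `E[N]`, `∑ xᵢ bᵢ` evaluates to zero on
all of `L`, so it vanishes, and the `bᵢ` are independent over `E`. -/
theorem lift_fixedAction_injective (hr : IsRegular N) {ι : Type*} {b : Module.Basis ι E E[N]}
    {bA : Module.Basis ι K (fixedAlgebra hN)} (hb : ∀ i, (bA i : E[N]) = b i) :
    Function.Injective
      (TensorProduct.lift ((LinearMap.mul K (Module.End K L)).compl₁₂
        (LinearMap.mul K L) (fixedAction hN).toLinearMap) :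
        L ⊗[K] fixedAlgebra hN →ₗ[K] Module.End K L) := by
  rw [injective_iff_map_eq_zero]
  intro t ht
  obtain ⟨c, rfl⟩ := TensorProduct.eq_repr_basis_right bA t
  have hsum : c.sum (fun i x => algebraMap L E x • b i) = 0 := by
    refine eq_zero_of_evalAt_eq_zero hr (QuotientGroup.mk 1) fun y => ?_
    have h := congrArg (algebraMap L E) (LinearMap.congr_fun ht y)
    simp only [Finsupp.sum, map_sum, LinearMap.coe_sum, Finset.sum_apply, TensorProduct.lift.tmul,
      LinearMap.compl₁₂_apply, LinearMap.mul_apply', Module.End.mul_apply, map_mul,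
      AlgHom.toLinearMap_apply, algebraMap_fixedAction, LinearMap.zero_apply, map_zero, hb] at h
    simpa only [Finsupp.sum, map_sum, map_smul, smul_eq_mul] using h
  have hc : c = 0 := by
    ext i
    have h := linearIndependent_iff'.mp b.linearIndependent c.support _ hsum
    by_cases hi : i ∈ c.support
    · simpa using h i hi
    · simpa using hi
  simp [hc]

end Invariants

end GreitherPareigis

/-- The direction of Greither-Pareigis from regular subgroups to Hopf Galois structures. -/
theorem hasHopfGaloisStructureOfType_of_isRegular {K L : Type*} {E : Type w} [Field K] [Field L]
    [Field E] [Algebra K L] [Algebra K E] [Algebra L E] [IsScalarTower K L E]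
    [FiniteDimensional K E] [IsGalois K E] [FiniteDimensional K L]
    {N : Subgroup (Equiv.Perm (Cosets K L E))}
    (hN : (lam K L E).range ≤ Subgroup.normalizer (N : Set (Equiv.Perm (Cosets K L E))))
    (hr : IsRegular N) {T : Type*} [Group T] (e : N ≃* T) :
    HasHopfGaloisStructureOfType K L E T := by
  have hfin : Finite N := Finite.of_equiv _ (hr.equiv (QuotientGroup.mk 1)).symm
  have hfinE : Module.Finite E E[N] :=
    Module.Finite.equiv (MonoidAlgebra.coeffLinearEquiv (S := E) (M := N) E).symm
  obtain ⟨ι, b, hb⟩ := exists_basis_fixed (fun σ => (galAct hN σ : E[N] →+ E[N]))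
    (galAct_smul hN) (galAct_one hN) (galAct_mul hN)
  obtain ⟨bA, hbA⟩ := exists_basis_fixedPoints (ρ := fun σ => (galAct hN σ : E[N] →+ E[N])) b
    (galAct_smul hN) hb (Subalgebra.toSubmodule (fixedAlgebra hN)) (mem_fixedAlgebra_iff hN)
  change Module.Basis ι K (fixedAlgebra hN) at bA
  change ∀ i, ((bA i : fixedAlgebra hN) : E[N]) = b i at hbA
  have : Finite ι := Module.Finite.finite_basis b
  have := Fintype.ofFinite ι
  have hfinA : Module.Finite K (fixedAlgebra hN) := Module.Finite.of_basis bA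
  have hinj := tensorIncl_injective (E := E) hbA
  have hinj₃ := tensorIncl₃_injective (E := E) hbA
  have hΔ : ∀ a : fixedAlgebra hN, Coalgebra.comul (R := E) (a : E[N]) ∈
      (tensorIncl (E := E) (fixedAlgebra hN)).range := fun a => by
    -- The coordinates of the comultiplication of an invariant element are invariant, so it comes
    -- from the tensor square over `K`.
    have hk : ∀ i : ι × ι, ∃ k : K, algebraMap K E k =
        (b.tensorProduct b).repr (Coalgebra.comul (R := E) (a : E[N])) i := fun i =>
      mem_range_algebraMap_of_fixed fun σ => by
        rw [← repr_comul_galAct hN b hb, (mem_fixedAlgebra_iff hN _).mp a.2]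
    choose k hk using hk
    refine ⟨∑ i : ι × ι, k i • (bA i.1 ⊗ₜ bA i.2), ?_⟩
    rw [map_sum]
    refine Eq.trans ?_ ((b.tensorProduct b).sum_repr _)
    refine Finset.sum_congr rfl fun i _ => ?_
    rw [← hk, algebraMap_smul, Module.Basis.tensorProduct_apply', ← hbA, ← hbA]
    exact map_smul (tensorIncl (E := E) (fixedAlgebra hN)) (k i) (bA i.1 ⊗ₜ bA i.2)
  have hε : ∀ a : fixedAlgebra hN, Coalgebra.counit (R := E) (a : E[N]) ∈
      (Algebra.ofId K E).range := fun a =>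
    mem_range_algebraMap_of_fixed fun σ => by
      rw [← counit_galAct hN, (mem_fixedAlgebra_iff hN _).mp a.2]
  have hS : ∀ a : fixedAlgebra hN, HopfAlgebra.antipode E (a : E[N]) ∈ fixedAlgebra hN := fun a =>
    (mem_fixedAlgebra_iff hN _).mpr fun σ => by
      rw [← antipode_galAct hN, (mem_fixedAlgebra_iff hN _).mp a.2]
  let := descHopfAlgebra (fixedAlgebra hN) hinj hΔ hε hS hinj₃
  have hcounit : ∀ a : fixedAlgebra hN, Coalgebra.counit (R := E) (a : E[N]) =
      algebraMap K E (Coalgebra.counit (R := K) a) := fun a =>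
    (algebraMap_descCounit (fixedAlgebra hN) hε a).symm
  have hcomul : ∀ a : fixedAlgebra hN, Coalgebra.comul (R := E) (a : E[N]) =
      tensorIncl (fixedAlgebra hN) (Coalgebra.comul (R := K) a) := fun a =>
    (tensorIncl_descComul (fixedAlgebra hN) hinj hΔ a).symm
  have hco : Coalgebra.IsCocomm K (fixedAlgebra hN) :=
    desc_isCocomm (fixedAlgebra hN) hinj hΔ hε hS hinj₃
  refine ⟨fixedAlgebra hN, inferInstance, inferInstance,
    hco, hfinA, ⟨fixedAction hN, fun x => ?_, fun x y z => ?_, ?_⟩, N, hN, hr, ⟨e⟩,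
    AlgEquiv.refl, hcounit, hcomul, algebraMap_fixedAction hN⟩
  · apply (algebraMap L E).injective
    rw [algebraMap_fixedAction, evalAt_one_right, hcounit, ← IsScalarTower.algebraMap_apply]
  · apply (algebraMap L E).injective
    rw [algebraMap_fixedAction, evalAt_mul_right, hcomul]
    generalize Coalgebra.comul (R := K) x = t
    induction t with
    | zero => simp
    | add s t hs ht => simp only [map_add, hs, ht]
    | tmul u v => simp [algebraMap_fixedAction]
  -- Both sides have dimension `[L : K] ^ 2`, because `|N| = |G/G'| = [L : K]`.
  · have hinj := lift_fixedAction_injective hN hr hbA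
    refine ⟨hinj, (LinearMap.injective_iff_surjective_of_finrank_eq_finrank ?_).mp hinj⟩
    rw [Module.finrank_tensorProduct, Module.finrank_linearMap, Module.finrank_eq_card_basis bA,
      ← Module.finrank_eq_card_basis b, (MonoidAlgebra.coeffLinearEquiv (S := E) (M := N) E).finrank_eq]
    have := Fintype.ofFinite N
    rw [Module.finrank_finsupp_self, ← Nat.card_eq_fintype_card, hr.card_eq, card_cosets]

theorem HasHopfGaloisStructureOfType.of_commutatorsCentral {K L E : Type*} [Field K] [Field L]
    [Field E] [Algebra K L] [Algebra K E] [Algebra L E] [IsScalarTower K L E]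
    [FiniteDimensional K E] [IsGalois K E] [FiniteDimensional K L]
    (hodd : Odd (Module.finrank K L)) {T T' : Type*} [Group T] [Group T']
    (hT : CommutatorsCentral T)
    (hTT' : ∀ (N : Subgroup (Equiv.Perm (Cosets K L E))) (hN : CommutatorsCentral N)
      (hcard : Odd (Nat.card N)), Nat.card N = Module.finrank K L → N ≃* T →
        Nonempty (sandwichSubgroup hN hcard ≃* T'))
    (h : HasHopfGaloisStructureOfType K L E T) : HasHopfGaloisStructureOfType K L E T' := by
  -- Only the regular subgroup is kept from the given structure.
  obtain ⟨H, _, _, _, _, S, N, hN, hr, ⟨e⟩, -⟩ := h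
  have hcard : Nat.card N = Module.finrank K L := hr.card_eq.trans (card_cosets K L E)
  obtain ⟨M, hNM, hM, ⟨f⟩⟩ := exists_isRegular_normalizer_le hr (hT.of_mulEquiv e)
    (hcard ▸ hodd)
  obtain ⟨g⟩ := hTT' N (hT.of_mulEquiv e) (hcard ▸ hodd) hcard e
  exact hasHopfGaloisStructureOfType_of_isRegular (hN.trans hNM) hM (f.trans g)

end HopfGalois

theorem mainTheorem4 (p : ℕ) (hp : p.Prime) (hodd : Odd p)
    (K L E : Type*) [Field K] [Field L] [Field E]
    [Algebra K L] [Algebra K E] [Algebra L E] [IsScalarTower K L E]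
    [Algebra.IsSeparable K L] (hdeg : Module.finrank K L = p ^ 3) [IsNormalClosure K L E] :
    (HopfGalois.HasHopfGaloisStructureOfType K L E (HopfGalois.Heisenberg p) →
      HopfGalois.HasHopfGaloisStructureOfType K L E
        (Multiplicative (ZMod p) × Multiplicative (ZMod p) × Multiplicative (ZMod p))) ∧
    (HopfGalois.HasHopfGaloisStructureOfType K L E (HopfGalois.Gp p) →
      HopfGalois.HasHopfGaloisStructureOfType K L E
        (Multiplicative (ZMod (p ^ 2)) × Multiplicative (ZMod p))) := by
  have : FiniteDimensional K L :=
    Module.finite_of_finrank_pos (by rw [hdeg]; exact pow_pos hp.pos 3)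
  have hnormal : Normal K E := IsNormalClosure.normal (K := L)
  -- `E` is the compositum of the images of `L`, so it inherits finiteness and separability and is
  -- Galois over `K`.
  have hclosure : IntermediateField.normalClosure K L E = ⊤ :=
    (Algebra.IsAlgebraic.isNormalClosure_iff.mp ‹_›).2
  have hE := normalClosure.is_finiteDimensional K L E
  rw [hclosure] at hE
  have : FiniteDimensional K E := Module.Finite.equiv IntermediateField.topEquiv.toLinearEquiv
  have hsep : Algebra.IsSeparable K (IntermediateField.normalClosure K L E) := by
    have (f : L →ₐ[K] E) : Algebra.IsSeparable K f.fieldRange :=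
      AlgEquiv.Algebra.isSeparable (AlgEquiv.ofInjectiveField f)
    rw [normalClosure_def]
    infer_instance
  rw [hclosure] at hsep
  have : Algebra.IsSeparable K E := AlgEquiv.Algebra.isSeparable IntermediateField.topEquiv
  have : IsGalois K E := ⟨⟩
  have hodd3 : Odd (Module.finrank K L) := hdeg ▸ hodd.pow
  refine ⟨.of_commutatorsCentral hodd3 (HopfGalois.Heisenberg.commutatorsCentral p) ?_,
    .of_commutatorsCentral hodd3 (HopfGalois.Gp.commutatorsCentral p) ?_⟩
  · exact fun N hN hN' hcard e =>
      HopfGalois.sandwichSubgroup_mulEquiv_of_heisenberg hN hN' hp hodd (hcard.trans hdeg) e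
  · exact fun N hN hN' hcard e =>
      HopfGalois.sandwichSubgroup_mulEquiv_of_gp hN hN' hp hodd (hcard.trans hdeg) e
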